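/- Let $N$ be a network with a finite set of cells $C$ and $k$ edge types, represented by functions $\sigma_1,\dots,\sigma_k:C\to C$ (the unique edge of type $i$ targeting the cell $c$ starts at $\sigma_i(c)$). Suppose that $N$ is connected (as an undirected graph) and feed-forward with layers $C_0,\dots,C_m$: these are nonempty sets partitioning $C$, $\sigma_i(c)=c$ for $c\in C_0$, $\sigma_i(C_j)\subseteq C_{j-1}$ for $1\le j\le m$ and all $i$, and every cell of $C_j$ with $j<m$ equals $\sigma_i(c')$ for some $c'\in C_{j+1}$ and some $i$. Let $\mathcal V_0(N)$ be the set of smooth functions $f:\mathbb R\times\mathbb R^k\times\mathbb R\to\mathbb R$, $(x_0,x_1,\dots,x_k,\lambda)\mapsto f(x_0,x_1,\dots,x_k,\lambda)$, such that $f(0,\dots,0,\lambda)=0$ for all $\lambda\in\mathbb R$ and $\frac{\partial f}{\partial x_0}(0,\dots,0)=0$. A statement holds for generic $f\in\mathcal V_0(N)$ if it holds for all $f$ in a subset of $\mathcal V_0(N)$ that is open in $\mathcal V_0(N)$ for the weak (compact-open) $C^\infty$ topology and dense in $\mathcal V_0(N)$ for the strong (Whitney) $C^\infty$ topology; such a subset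 is open and dense for both topologies. A bifurcation branch of $f$ on $N$ is a continuous map $b=(b_c)_{c\in C}:D\to\mathbb R^{C}$, where $D$ is $[0,\lambda_0[$, $]-\lambda_0,0]$ or $]-\lambda_0,\lambda_0[$ for some $\lambda_0>0$, such that $b$ is smooth on $D\setminus\{0\}$, satisfies $$f\bigl(b_c(\lambda),b_{\sigma_1(c)}(\lambda),\dots,b_{\sigma_k(c)}(\lambda),\lambda\bigr)=0\qquad\text{for all } c\in C,\ \lambda\in D,$$ and does not vanish identically on any neighborhood of $0$ in $D$. Let $D=[0,\lambda_0[$ or $D=\,]-\lambda_0,0]$. If $b_c$ vanishes identically on $D$, then $b_c$ has square-root-order $-1$. Otherwise $b_c$ has square-root-order $p$ if $p$ is the smallest non-negative integer for which there is a smooth function $b_c^*:[0,\lambda_0^{2^{-p}}[\to\mathbb R$ such that $b_c(\lambda)=b_c^*(|\lambda|^{2^{-p}})$ for all $\lambda\in D$ and the limit of $b_c^*(|\lambda|)/\lambda$ as $\lambda\to0$, $\lambda\in D\setminus\{0\}$, exists and is nonzero. For $A\subseteq C$, write $b_A\sim\mathcal O(2^{-p})$ if $b_c$ has a square-root-order for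 every $c\in A$ and the maximum of these orders is $p$. Then, for generic $f\in\mathcal V_0(N)$, the following holds: for every $1\le r\le m$ there is a bifurcation branch $b:D\to\mathbb R^C$ of $f$ on $N$, with $D$ one-sided as above, such that $$b_{C_0}=\dots=b_{C_{r-1}}=0,\quad b_{C_r}\sim\mathcal O(2^{0}),\quad b_{C_{r+1}}\sim\mathcal O(2^{-1}),\ \dots,\ b_{C_m}\sim\mathcal O(2^{-(m-r)}).$$ -/

import Mathlib

open Set Filter
open scoped Topology ContDiff

namespace FFN

/-- Layers `L 0, …, L m` exhibiting as a feed-forward network the network with cell set `C` and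
`k` edge types, represented by `σ i : C → C` (the edge of type `i` targeting `c` starts at
`σ i c`). -/
structure IsFeedForward {C : Type*} {k m : ℕ} (σ : Fin k → C → C) (L : Fin (m + 1) → Set C) :
    Prop where
  layer_nonempty : ∀ j, (L j).Nonempty
  layer_disjoint : ∀ i j, i ≠ j → Disjoint (L i) (L j)
  layer_cover : ⋃ j, L j = univ
  fixed : ∀ i, ∀ c ∈ L 0, σ i c = c
  feed : ∀ i, ∀ j : Fin m, ∀ c ∈ L j.succ, σ i c ∈ L j.castSucc
  feeds_next : ∀ j : Fin m, ∀ c ∈ L j.castSucc, ∃ c' ∈ L j.succ, ∃ i, c = σ i c'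

/-- Any two cells are joined by a chain of edges, regardless of their directions. -/
def IsConnectedNetwork {C : Type*} {k : ℕ} (σ : Fin k → C → C) : Prop :=
  ∀ c c' : C, Relation.EqvGen (fun a b => ∃ i, a = σ i b) c c'

/-- The arguments `(x₀, (x₁, …, x_k), t)`: internal variable, inputs, parameter. -/
abbrev Arg (k : ℕ) : Type := ℝ × (Fin k → ℝ) × ℝ

/-- The parametrized admissible vector field defined by `f` on the network given by `σ`. -/
def field {C : Type*} {k : ℕ} (σ : Fin k → C → C) (f : Arg k → ℝ) (x : C → ℝ) (t : ℝ) :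
    C → ℝ :=
  fun c => f (x c, fun i => x (σ i c), t)

/-- Smooth families with the fully synchronous equilibrium `0` for every parameter value. -/
def V (k : ℕ) : Set (Arg k → ℝ) :=
  {f | ContDiff ℝ ∞ f ∧ ∀ t : ℝ, f (0, 0, t) = 0}

/-- The bifurcation condition associated with the internal dynamics:
the partial derivative of `f` in `x₀` vanishes at the origin. -/
def V₀ (k : ℕ) : Set (Arg k → ℝ) :=
  {f | f ∈ V k ∧ deriv (fun x : ℝ => f (x, 0, 0)) 0 = 0}

/-- `G ⊆ X` is open in `X` for the weak (compact-open) `C^∞` topology. -/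
def IsWeaklyOpenIn {k : ℕ} (G X : Set (Arg k → ℝ)) : Prop :=
  ∀ f ∈ G, ∃ (K : Set (Arg k)) (n : ℕ) (ε : ℝ), IsCompact K ∧ 0 < ε ∧
    ∀ g ∈ X, (∀ v ∈ K, ∀ j ≤ n, ‖iteratedFDeriv ℝ j (fun w => g w - f w) v‖ < ε) → g ∈ G

/-- `G ⊆ X` is dense in `X` for the strong (Whitney) `C^∞` topology. -/
def IsStronglyDenseIn {k : ℕ} (G X : Set (Arg k → ℝ)) : Prop :=
  ∀ f ∈ X, ∀ (n : ℕ) (ε : Arg k → ℝ), Continuous ε → (∀ v, 0 < ε v) →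
    ∃ g ∈ G, ∀ v, ∀ j ≤ n, ‖iteratedFDeriv ℝ j (fun w => g w - f w) v‖ < ε v

/-- `P` holds for generic `f ∈ X`: it holds on a subset of `X` that is open for the weak and dense
for the strong `C^∞` topology, hence open and dense for both of them. -/
def Generically {k : ℕ} (X : Set (Arg k → ℝ)) (P : (Arg k → ℝ) → Prop) : Prop :=
  ∃ G ⊆ X, IsWeaklyOpenIn G X ∧ IsStronglyDenseIn G X ∧ ∀ f ∈ G, P f

/-- The three kinds of domains of branches. -/
def IsBranchDomain (D : Set ℝ) : Prop :=
  ∃ a : ℝ, 0 < a ∧ (D = Ioc (-a) 0 ∨ D = Ioo (-a) a ∨ D = Ico 0 a)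

/-- `b : D → ℝ^C` is (a representative of) an equilibrium branch of `f`. Smoothness is only
required off the bifurcation value `0`: a branch behaving like `√t` is not smooth there. -/
structure IsEquilibriumBranch {C : Type*} [Fintype C] {k : ℕ} (σ : Fin k → C → C)
    (f : Arg k → ℝ) (D : Set ℝ) (b : ℝ → C → ℝ) : Prop where
  domain : IsBranchDomain D
  continuousOn : ContinuousOn b D
  smoothOn : ContDiffOn ℝ ∞ b (D \ {0})
  equilibrium : ∀ t ∈ D, field σ f (b t) t = 0

/-- An equilibrium branch whose germ at `0` is not the trivial one. -/
def IsBifurcationBranch {C : Type*} [Fintype C] {k : ℕ} (σ : Fin k → C → C)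
    (f : Arg k → ℝ) (D : Set ℝ) (b : ℝ → C → ℝ) : Prop :=
  IsEquilibriumBranch σ f D b ∧ ¬ ∀ᶠ t in 𝓝[D] 0, b t = 0

/-- `D` is a one-sided domain of length `a` and `β(t) = γ(|t|^(2^(-q)))` on `D` for some smooth
`γ : [0, a^(2^(-q))) → ℝ` such that `γ(|t|) / t → s ≠ 0` as `t → 0` in `D`. -/
def HasRootExpansion (D : Set ℝ) (β : ℝ → ℝ) (q : ℕ) (s : ℝ) : Prop :=
  ∃ a : ℝ, 0 < a ∧ (D = Ico 0 a ∨ D = Ioc (-a) 0) ∧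
    ∃ γ : ℝ → ℝ, ContDiffOn ℝ ∞ γ (Ico 0 (a ^ ((2 : ℝ) ^ q)⁻¹)) ∧
      (∀ t ∈ D, β t = γ (|t| ^ ((2 : ℝ) ^ q)⁻¹)) ∧
      Tendsto (fun t => γ |t| / t) (𝓝[D \ {0}] 0) (𝓝 s) ∧ s ≠ 0

/-- `β : D → ℝ` has square-root-order `p`: `-1` if `β = 0`, and otherwise the smallest `q` for
which there is an expansion as above. -/
def HasSqrtOrder (D : Set ℝ) (β : ℝ → ℝ) (p : ℤ) : Prop :=
  (p = -1 ∧ ∀ t ∈ D, β t = 0) ∨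
    ((¬ ∀ t ∈ D, β t = 0) ∧
      ∃ n : ℕ, p = n ∧ IsLeast {q : ℕ | ∃ s, HasRootExpansion D β q s} n)

/-- `b` has square-root-order `p` in the set of cells `A`: all `b_c`, `c ∈ A`, have a
square-root-order, and the maximum of these is `p`. -/
def HasSqrtOrderIn {C : Type*} (D : Set ℝ) (b : ℝ → C → ℝ) (A : Set C) (p : ℤ) : Prop :=
  (∀ c ∈ A, ∃ q, HasSqrtOrder D (fun t => b t c) q) ∧
    IsGreatest {q : ℤ | ∃ c ∈ A, HasSqrtOrder D (fun t => b t c) q} p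

end FFN

namespace FFN

/-! All cells of one layer are given a common value. Every input of a cell then carries the value of
the previous layer, so the equilibrium equations reduce to a chain `F (x, y, t) = 0` with `F (x, y,
t) = f (x, (y, …, y), t)`, where `x` is the value of a layer and `y` that of the layer before it.
Hadamard's lemma turns `F` into `y P + x² R + x t S` (`exists_isNormalForm`), and generically `P`,
`R`, `S` are nonzero at the origin.

Layers below `r` are zero. Layer `r` sees `y = 0` and takes the nonzero solution of a transcritical
bifurcation, of order `t` (`IsNormalForm.exists_transcritical`). Each later layer balances `x² R`
against `y P`, so its size is the square root of that of its predecessor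
(`IsNormalForm.exists_square_root`). The root is real when the leading coefficient of `y` has sign
opposite to `P 0 * R 0`. The side of `0` on which `t` lies secures this for layer `r`, and the
choice between the two square roots passes it on from layer to layer. After substituting `u =
|t|^(2^(-j))` and dividing by a power of `u`, each equation is regular, so the implicit function
theorem gives solutions smooth in `u`.

The orders are exact because an expansion determines the decay rate of the branch, hence its
exponent (`HasRootExpansion.le`). Genericity holds since finitely many derivatives at the origin are
required to be nonzero: this is an open condition, and a small multiple of a cut-off polynomial
achieves it. -/

/-! ### Smooth division and implicit functions -/

/-- Integrals of smooth functions over a compact interval depend smoothly on parameters. -/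
theorem contDiff_intervalIntegral_of_contDiff {E : Type} [NormedAddCommGroup E] [NormedSpace ℝ E]
    (a b : ℝ) (n : ℕ) : ∀ {G : Type} [NormedAddCommGroup G] [NormedSpace ℝ G]
    {F : E × ℝ → G}, ContDiff ℝ ∞ F → ContDiff ℝ n (fun x => ∫ s in a..b, F (x, s)) := by
  induction n with
  | zero =>
    intro G _ _ F hF
    rw [Nat.cast_zero, contDiff_zero]
    exact intervalIntegral.continuous_parametric_intervalIntegral_of_continuous'
      (f := fun x s => F (x, s)) hF.continuous a b
  | succ n ih =>
    intro G _ _ F hF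
    have hF1 : Differentiable ℝ F := hF.differentiable (by simp)
    let F' : E × ℝ → E →L[ℝ] G := fun p => (fderiv ℝ F p).comp (ContinuousLinearMap.inl ℝ E ℝ)
    have hF' : ContDiff ℝ ∞ F' :=
      (hF.fderiv_right (m := ∞) (by simp)).clm_comp contDiff_const
    have hderiv : ∀ x : E, ∀ s : ℝ, HasFDerivAt (fun x => F (x, s)) (F' (x, s)) x := by
      intro x s
      exact (hF1 (x, s)).hasFDerivAt.comp x (hasFDerivAt_prodMk_left x s)
    have key : ∀ x₀ : E, HasFDerivAt (fun x => ∫ s in a..b, F (x, s))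
        (∫ s in a..b, F' (x₀, s)) x₀ := by
      intro x₀
      obtain ⟨M, hM⟩ := (isCompact_uIcc (a := a) (b := b)).exists_bound_of_continuousOn
        (f := fun s => F' (x₀, s)) (by
          exact (hF'.continuous.comp (by fun_prop)).continuousOn)
      -- Compactness of the interval makes the bound uniform in `s`, giving a constant dominating
      -- function.
      have hnear : ∀ᶠ x in 𝓝 x₀, ∀ s ∈ uIcc a b, ‖F' (x, s)‖ < M + 1 := by
        refine (isCompact_uIcc (a := a) (b := b)).eventually_forall_of_forall_eventually ?_
        intro s hs
        have hc : ContinuousAt (fun p : E × ℝ => ‖F' p‖) (x₀, s) :=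
          (hF'.continuous.norm).continuousAt
        exact hc.eventually_lt_const (by linarith [hM s hs])
      refine intervalIntegral.hasFDerivAt_integral_of_dominated_of_fderiv_le (𝕜 := ℝ)
        (F := fun x s => F (x, s)) (F' := fun x s => F' (x, s)) (bound := fun _ => M + 1)
        (s := {x | ∀ s ∈ uIcc a b, ‖F' (x, s)‖ < M + 1}) hnear ?_ ?_ ?_ ?_ ?_ ?_
      · exact .of_forall fun x =>
          ((hF.continuous.comp (by fun_prop : Continuous fun s : ℝ => (x, s)))).aestronglyMeasurable
      · exact (hF.continuous.comp (by fun_prop : Continuous fun s : ℝ => (x₀, s))).intervalIntegrable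
          _ _
      · exact (hF'.continuous.comp
          (by fun_prop : Continuous fun s : ℝ => (x₀, s))).aestronglyMeasurable
      · exact .of_forall fun s hs x hx => (hx s (uIoc_subset_uIcc hs)).le
      · exact intervalIntegrable_const
      · exact .of_forall fun s _ x _ => hderiv x s
    rw [Nat.cast_succ]
    exact contDiff_succ_iff_hasFDerivAt.2 ⟨fun x => ∫ s in a..b, F' (x, s), ih hF', key⟩

/-- Hadamard's lemma: a smooth function vanishing for `x = 0` is divisible by `x`. -/
theorem exists_contDiff_eq_mul {E : Type} [NormedAddCommGroup E] [NormedSpace ℝ E]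
    {F : ℝ × E → ℝ} (hF : ContDiff ℝ ∞ F) (h0 : ∀ e, F (0, e) = 0) :
    ∃ H : ℝ × E → ℝ, ContDiff ℝ ∞ H ∧ ∀ x e, F (x, e) = x * H (x, e) := by
  have hF1 : Differentiable ℝ F := hF.differentiable (by simp)
  -- The quotient is the average of `∂F/∂x` over the segment from `(0, e)` to `(x, e)`.
  let F' : (ℝ × E) × ℝ → ℝ := fun q => fderiv ℝ F (q.2 * q.1.1, q.1.2) (1, 0)
  have hF' : ContDiff ℝ ∞ F' :=
    ((hF.fderiv_right (m := ∞) (by simp)).comp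
      (by fun_prop : ContDiff ℝ ∞ fun q : (ℝ × E) × ℝ => (q.2 * q.1.1, q.1.2))).clm_apply
      contDiff_const
  refine ⟨fun p => ∫ s in (0 : ℝ)..1, F' (p, s), ?_, ?_⟩
  · rw [contDiff_infty]
    exact fun n => contDiff_intervalIntegral_of_contDiff 0 1 n hF'
  · intro x e
    have hd : ∀ s : ℝ, HasDerivAt (fun s => F (s * x, e)) (x * F' ((x, e), s)) s := by
      intro s
      have h1 : HasDerivAt (fun s : ℝ => (s * x, e)) (x, 0) s := by
        simpa using ((hasDerivAt_id s).mul_const x).prodMk (hasDerivAt_const s e)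
      have h2 := (hF1 (s * x, e)).hasFDerivAt.comp_hasDerivAt s h1
      have h3 : fderiv ℝ F (s * x, e) (x, 0) = x * F' ((x, e), s) := by
        have : ((x, 0) : ℝ × E) = x • (1, 0) := by simp
        rw [this, map_smul]; rfl
      rwa [h3] at h2
    have := intervalIntegral.integral_eq_sub_of_hasDerivAt (a := 0) (b := 1) (fun s _ => hd s)
      ((continuous_const.mul (hF'.continuous.comp (by fun_prop))).intervalIntegrable _ _)
    simp only [one_mul, zero_mul, h0, sub_zero, intervalIntegral.integral_const_mul] at this
    exact this.symm

/-- A function smooth near a point agrees near this point with a globally smooth one. -/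
theorem exists_contDiff_eventuallyEq {φ : ℝ → ℝ} {x₀ : ℝ}
    (h : ∀ᶠ x in 𝓝 x₀, ContDiffAt ℝ ∞ φ x) :
    ∃ ψ : ℝ → ℝ, ContDiff ℝ ∞ ψ ∧ ψ =ᶠ[𝓝 x₀] φ := by
  obtain ⟨δ, hδ, hball⟩ := Metric.eventually_nhds_iff_ball.1 h
  let χ : ContDiffBump x₀ := ⟨δ / 4, δ / 2, by positivity, by linarith⟩
  refine ⟨fun x => χ x * φ x, contDiff_iff_contDiffAt.2 fun x => ?_, ?_⟩
  · by_cases hx : x ∈ Metric.ball x₀ δ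
    · exact χ.contDiff.contDiffAt.mul (hball x hx)
    · have hx' : x ∉ tsupport χ := by
        rw [χ.tsupport_eq]
        intro hx'
        exact hx (Metric.closedBall_subset_ball (show δ / 2 < δ by linarith) hx')
      have : (fun x => χ x * φ x) =ᶠ[𝓝 x] fun _ => 0 := by
        filter_upwards [notMem_tsupport_iff_eventuallyEq.1 hx'] with y hy
        simp [hy]
      exact contDiffAt_const.congr_of_eventuallyEq this
  · filter_upwards [χ.eventuallyEq_one] with x hx
    simp [hx]

/-- The shear `(u, z) ↦ (u, a u + d z)`. -/
noncomputable def shearEquiv (a d : ℝ) (hd : d ≠ 0) : (ℝ × ℝ) ≃L[ℝ] (ℝ × ℝ) :=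
  ContinuousLinearEquiv.equivOfInverse
    ((ContinuousLinearMap.fst ℝ ℝ ℝ).prod
      (a • ContinuousLinearMap.fst ℝ ℝ ℝ + d • ContinuousLinearMap.snd ℝ ℝ ℝ))
    ((ContinuousLinearMap.fst ℝ ℝ ℝ).prod
      (d⁻¹ • (ContinuousLinearMap.snd ℝ ℝ ℝ - a • ContinuousLinearMap.fst ℝ ℝ ℝ)))
    (fun p => by ext <;> simp; field_simp) (fun p => by ext <;> simp; field_simp; ring)

/-- A scalar implicit function theorem with a globally smooth solution. -/
theorem exists_contDiff_implicit {h : ℝ × ℝ → ℝ} (hh : ContDiff ℝ ∞ h) {z₀ d : ℝ}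
    (h0 : h (0, z₀) = 0) (hd : HasDerivAt (fun z => h (0, z)) d z₀) (hd0 : d ≠ 0) :
    ∃ z : ℝ → ℝ, ContDiff ℝ ∞ z ∧ z 0 = z₀ ∧ ∀ᶠ u in 𝓝 0, h (u, z u) = 0 := by
  have hh1 : Differentiable ℝ h := hh.differentiable (by simp)
  let Φ : ℝ × ℝ → ℝ × ℝ := fun p => (p.1, h p)
  have hΦ : ContDiff ℝ ∞ Φ := contDiff_fst.prodMk hh
  have hΦ' : ∀ p, ∀ hp : fderiv ℝ h p (0, 1) ≠ 0,
      HasFDerivAt Φ (shearEquiv (fderiv ℝ h p (1, 0)) (fderiv ℝ h p (0, 1)) hp : _ →L[ℝ] _) p := by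
    intro p hp
    have h1 : HasFDerivAt Φ ((ContinuousLinearMap.fst ℝ ℝ ℝ).prod (fderiv ℝ h p)) p :=
      hasFDerivAt_fst.prodMk (hh1 p).hasFDerivAt
    convert h1 using 1
    ext <;> simp [shearEquiv, ContinuousLinearEquiv.equivOfInverse]
  have hp0 : fderiv ℝ h (0, z₀) (0, 1) ≠ 0 := by
    have h1 : HasDerivAt (fun z => h (0, z)) (fderiv ℝ h (0, z₀) (0, 1)) z₀ :=
      (hh1 (0, z₀)).hasFDerivAt.comp_hasDerivAt z₀
        ((hasDerivAt_const z₀ (0 : ℝ)).prodMk (hasDerivAt_id z₀))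
    rwa [h1.unique hd]
  let e := hΦ.contDiffAt.toOpenPartialHomeomorph Φ (hΦ' _ hp0) (by simp)
  have he : ∀ p, e p = Φ p := fun p => rfl
  have hsrc : (0, z₀) ∈ e.source :=
    hΦ.contDiffAt.mem_toOpenPartialHomeomorph_source (hΦ' _ hp0) (by simp)
  have he0 : e (0, z₀) = (0, 0) := by rw [he]; simp [Φ, h0]
  have htgt : ((0, 0) : ℝ × ℝ) ∈ e.target := he0 ▸ e.map_source hsrc
  have hsymm0 : e.symm (0, 0) = (0, z₀) := by rw [← he0, e.left_inv hsrc]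
  have hι : Tendsto (fun u : ℝ => ((u, 0) : ℝ × ℝ)) (𝓝 0) (𝓝 (0, 0)) :=
    (by fun_prop : Continuous fun u : ℝ => ((u, 0) : ℝ × ℝ)).tendsto 0
  have hev : ∀ᶠ u : ℝ in 𝓝 0, ((u, 0) : ℝ × ℝ) ∈ e.target :=
    hι.eventually (e.open_target.mem_nhds htgt)
  -- Smoothness of the inverse is needed on a whole neighbourhood, so invertibility of the
  -- derivative must persist near the base point.
  have hev2 : ∀ᶠ u : ℝ in 𝓝 0, fderiv ℝ h (e.symm (u, 0)) (0, 1) ≠ 0 := by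
    have hc : Continuous fun p => fderiv ℝ h p (0, 1) :=
      (hh.continuous_fderiv (by simp)).clm_apply continuous_const
    have ht : Tendsto (fun u : ℝ => e.symm (u, 0)) (𝓝 0) (𝓝 (0, z₀)) := by
      have := (e.continuousAt_symm htgt).tendsto
      rw [hsymm0] at this
      exact this.comp hι
    exact ((hc.tendsto _).comp ht).eventually_ne hp0
  obtain ⟨z, hz, hzeq⟩ := exists_contDiff_eventuallyEq (φ := fun u => (e.symm (u, 0)).2)
    (x₀ := 0) (by
      filter_upwards [hev, hev2] with u hu hu2
      have hs : ContDiffAt ℝ ∞ e.symm (u, 0) :=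
        e.contDiffAt_symm hu (hΦ' _ hu2) hΦ.contDiffAt
      have : ContDiffAt ℝ ∞ (fun u : ℝ => e.symm (u, 0)) u :=
        ContDiffAt.comp u (f := fun u : ℝ => ((u, 0) : ℝ × ℝ)) (g := e.symm) hs (by fun_prop)
      exact contDiffAt_snd.comp u this)
  refine ⟨z, hz, ?_, ?_⟩
  · rw [hzeq.eq_of_nhds, hsymm0]
  · filter_upwards [hzeq, hev] with u hu hut
    have h1 : Φ (e.symm (u, 0)) = (u, 0) := e.right_inv hut
    have h2 : (e.symm (u, 0)).1 = u := congrArg Prod.fst h1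
    have h3 : h (e.symm (u, 0)) = 0 := congrArg Prod.snd h1
    rw [hu]
    convert h3 using 2
    exact Prod.ext h2.symm rfl

/-- The difference quotient at `0` is `φ` itself, so continuity replaces the differentiability
required by the product rule. -/
theorem hasDerivAt_mul_of_continuousAt {φ : ℝ → ℝ} (hφ : ContinuousAt φ 0) :
    HasDerivAt (fun t => t * φ t) (φ 0) 0 := by
  rw [hasDerivAt_iff_tendsto_slope_zero]
  refine (hφ.tendsto.mono_left nhdsWithin_le_nhds).congr' ?_
  filter_upwards [self_mem_nhdsWithin] with t ht
  have : t ≠ 0 := ht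
  simp [this]

/-! ### Normal form and the chain of layer equations -/

/-- The restriction `(x, y, t) ↦ f (x, (y, …, y), t)` has the form
`y P + x² R + x t S` with smooth coefficients. -/
structure IsNormalForm (F : ℝ × ℝ × ℝ → ℝ) (P : ℝ × ℝ × ℝ → ℝ) (R : ℝ × ℝ → ℝ) (S : ℝ → ℝ) :
    Prop where
  smooth_P : ContDiff ℝ ∞ P
  smooth_R : ContDiff ℝ ∞ R
  smooth_S : ContDiff ℝ ∞ S
  eq : ∀ x y t, F (x, y, t) = y * P (y, x, t) + x ^ 2 * R (x, t) + x * t * S t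

/-- Four divisions: `y` out of the dependence on the input, `x` out of `F (x, 0, t)` by the trivial
equilibrium, then `x` and `t` out of the two parts of the quotient `Q (x, t) = (Q (x, t) - Q (0, t))
+ Q (0, t)`. The last division is possible because the bifurcation condition says `Q (0, 0) = 0`. -/
theorem exists_isNormalForm {F : ℝ × ℝ × ℝ → ℝ} (hF : ContDiff ℝ ∞ F)
    (h0 : ∀ t, F (0, 0, t) = 0) (h1 : deriv (fun x => F (x, 0, 0)) 0 = 0) :
    ∃ P R S, IsNormalForm F P R S := by
  obtain ⟨Q, hQ, hQF⟩ := exists_contDiff_eq_mul (E := ℝ) (F := fun p => F (p.1, 0, p.2))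
    (hF.comp (by fun_prop)) h0
  obtain ⟨R, hR, hRQ⟩ := exists_contDiff_eq_mul (E := ℝ) (F := fun p => Q p - Q (0, p.2))
    (hQ.sub (hQ.comp (by fun_prop))) (by simp)
  have hQ0 : Q (0, 0) = 0 := by
    have h2 : (fun x => F (x, 0, 0)) = fun x => x * Q (x, 0) := funext fun x => hQF x 0
    have h3 := hasDerivAt_mul_of_continuousAt (φ := fun x => Q (x, 0))
      ((hQ.continuous.comp (by fun_prop)).continuousAt)
    rw [h2, h3.deriv] at h1
    exact h1
  obtain ⟨S, hS, hSQ⟩ := exists_contDiff_eq_mul (E := ℝ) (F := fun p => Q (0, p.1))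
    (hQ.comp (by fun_prop)) (fun _ => hQ0)
  obtain ⟨P, hP, hPF⟩ := exists_contDiff_eq_mul (E := ℝ × ℝ)
    (F := fun p => F (p.2.1, p.1, p.2.2) - F (p.2.1, 0, p.2.2))
    ((hF.comp (by fun_prop)).sub (hF.comp (by fun_prop))) (by simp)
  refine ⟨P, R, fun t => S (t, 0), hP, hR, hS.comp (by fun_prop), fun x y t => ?_⟩
  have e1 := hQF x t
  have e2 := hRQ x t
  have e3 := hSQ t 0
  have e4 := hPF y (x, t)
  simp only at e1 e2 e3 e4
  linear_combination e4 + e1 + x * e2 + x * e3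

variable {F P : ℝ × ℝ × ℝ → ℝ} {R : ℝ × ℝ → ℝ} {S : ℝ → ℝ}

theorem IsNormalForm.hasDerivAt_input (h : IsNormalForm F P R S) :
    HasDerivAt (fun y => F (0, y, 0)) (P 0) 0 := by
  have h1 : (fun y => F (0, y, 0)) = fun y => y * P (y, 0, 0) := by
    funext y; simp [h.eq]
  rw [h1]
  exact hasDerivAt_mul_of_continuousAt (φ := fun y => P (y, 0, 0))
    ((h.smooth_P.continuous.comp (by fun_prop)).continuousAt)

theorem IsNormalForm.deriv_deriv_parameter (h : IsNormalForm F P R S) :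
    deriv (fun t => deriv (fun x => F (x, 0, t)) 0) 0 = S 0 := by
  have h1 : ∀ t, deriv (fun x => F (x, 0, t)) 0 = t * S t := by
    intro t
    have h2 : (fun x => F (x, 0, t)) = fun x => x * (x * R (x, t) + t * S t) := by
      funext x; rw [h.eq]; ring
    rw [h2]
    have hc : Continuous fun x => x * R (x, t) + t * S t :=
      (continuous_id.mul (h.smooth_R.continuous.comp (by fun_prop))).add continuous_const
    simpa using (hasDerivAt_mul_of_continuousAt hc.continuousAt).deriv
  simp only [h1]
  exact (hasDerivAt_mul_of_continuousAt h.smooth_S.continuous.continuousAt).deriv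

theorem IsNormalForm.deriv_deriv_internal (h : IsNormalForm F P R S) :
    deriv (fun t => deriv (fun x => F (t + x, 0, 0)) 0) 0 = 2 * R 0 := by
  have hr : ContDiff ℝ ∞ fun x => R (x, 0) := h.smooth_R.comp (by fun_prop)
  have h1 : ∀ t, deriv (fun x => F (t + x, 0, 0)) 0
      = t * (2 * R (t, 0) + t * deriv (fun x => R (x, 0)) t) := by
    intro t
    have h2 : (fun x => F (x, 0, 0)) = fun x => x ^ 2 * R (x, 0) := by
      funext x; simp [h.eq]
    have h3 : HasDerivAt (fun x => F (x, 0, 0))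
        (t * (2 * R (t, 0) + t * deriv (fun x => R (x, 0)) t)) (t + 0) := by
      rw [h2, add_zero]
      have := (hasDerivAt_pow 2 t).mul ((hr.differentiable (by simp)) t).hasDerivAt
      refine this.congr_deriv ?_
      simp; ring
    exact (h3.comp_const_add t 0).deriv
  simp only [h1]
  have hc : Continuous fun t => 2 * R (t, 0) + t * deriv (fun x => R (x, 0)) t :=
    (continuous_const.mul hr.continuous).add (continuous_id.mul (hr.continuous_deriv (by simp)))
  have hR0 : R (0, 0) = R 0 := rfl
  simpa [hR0] using (hasDerivAt_mul_of_continuousAt hc.continuousAt).deriv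

theorem IsNormalForm.exists_transcritical (h : IsNormalForm F P R S) (hP : P 0 ≠ 0) (hR : R 0 ≠ 0)
    (hS : S 0 ≠ 0) :
    ∃ ε : ℝ, (ε = 1 ∨ ε = -1) ∧ ∃ g : ℝ → ℝ, ContDiff ℝ ∞ g ∧ g 0 * (P 0 * R 0) < 0 ∧
      ∀ᶠ u in 𝓝 0, F (u * g u, 0, ε * u) = 0 := by
  -- The leading coefficient will be `-ε S 0 / R 0`; its product with `P 0 * R 0` is `-ε S 0 P 0`,
  -- which this `ε` makes negative.
  obtain ⟨ε, hε, hpos⟩ : ∃ ε : ℝ, (ε = 1 ∨ ε = -1) ∧ 0 < ε * (S 0 * P 0) := by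
    rcases lt_or_gt_of_ne (mul_ne_zero hS hP) with h1 | h1
    · exact ⟨-1, Or.inr rfl, by linarith⟩
    · exact ⟨1, Or.inl rfl, by linarith⟩
  have hRs := h.smooth_R
  have hSs := h.smooth_S
  -- With `x = u z`, `y = 0`, `t = ε u`, the normal form is `u² z` times this function.
  obtain ⟨g, hg, hg0, hgev⟩ := exists_contDiff_implicit
    (h := fun p => p.2 * R (p.1 * p.2, ε * p.1) + ε * S (ε * p.1)) (z₀ := -(ε * S 0) / R 0)
    (d := R 0) (by fun_prop)
    (by
      have : R (0, 0) = R 0 := rfl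
      simp only [zero_mul, mul_zero, this]; field_simp; ring)
    (by
      have : R (0, 0) = R 0 := rfl
      simpa [this] using ((hasDerivAt_id (-(ε * S 0) / R 0)).mul_const (R 0)).add_const (ε * S 0))
    hR
  refine ⟨ε, hε, g, hg, ?_, ?_⟩
  · rw [hg0]
    have : -(ε * S 0) / R 0 * (P 0 * R 0) = -(ε * (S 0 * P 0)) := by field_simp
    linarith
  · filter_upwards [hgev] with u hu
    rw [h.eq]
    linear_combination u ^ 2 * g u * hu

/-- Rescaling `x = u z` makes `y P` and `x² R` both of order `u²`, while `x t S` has order `u ^ (e +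
3)` and drops out at `u = 0`. What remains is `g(0) P 0 + z² R 0 = 0`, with two simple real roots by
the sign hypothesis; the root with `z P 0 R 0 < 0` restores that hypothesis for the next layer. -/
theorem IsNormalForm.exists_square_root (h : IsNormalForm F P R S) (hR : R 0 ≠ 0)
    {g : ℝ → ℝ} (hg : ContDiff ℝ ∞ g) (hsign : g 0 * (P 0 * R 0) < 0) (ε : ℝ) (e : ℕ) :
    ∃ g' : ℝ → ℝ, ContDiff ℝ ∞ g' ∧ g' 0 * (P 0 * R 0) < 0 ∧
      ∀ᶠ u in 𝓝 0, F (u * g' u, u ^ 2 * g (u ^ 2), ε * u ^ (e + 2)) = 0 := by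
  have hP : P 0 ≠ 0 := by rintro h0; simp [h0] at hsign
  have hpos : 0 < -(g 0 * P 0) / R 0 := by
    have : -(g 0 * P 0) / R 0 = -(g 0 * (P 0 * R 0)) / R 0 ^ 2 := by field_simp
    rw [this]
    have : 0 < -(g 0 * (P 0 * R 0)) := by linarith
    positivity
  obtain ⟨z₀, hz₀, hz₀s⟩ : ∃ z₀ : ℝ, z₀ ^ 2 = -(g 0 * P 0) / R 0 ∧ z₀ * (P 0 * R 0) < 0 := by
    have hs := Real.sq_sqrt hpos.le
    have hs0 := Real.sqrt_pos.2 hpos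
    rcases lt_or_gt_of_ne (mul_ne_zero hP hR) with h1 | h1
    · exact ⟨_, hs, mul_neg_of_pos_of_neg hs0 h1⟩
    · exact ⟨-_, by rw [neg_sq, hs], mul_neg_of_neg_of_pos (by linarith) h1⟩
  have hz0 : z₀ ≠ 0 := by rintro rfl; simp at hz₀s
  have hPs := h.smooth_P
  have hRs := h.smooth_R
  have hSs := h.smooth_S
  have hP0 : P (0, 0, 0) = P 0 := rfl
  have hR0 : R (0, 0) = R 0 := rfl
  obtain ⟨g', hg', hg'0, hgev⟩ := exists_contDiff_implicit
    (h := fun p => g (p.1 ^ 2) * P (p.1 ^ 2 * g (p.1 ^ 2), p.1 * p.2, ε * p.1 ^ (e + 2))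
      + p.2 ^ 2 * R (p.1 * p.2, ε * p.1 ^ (e + 2))
      + p.2 * ε * p.1 ^ (e + 1) * S (ε * p.1 ^ (e + 2))) (z₀ := z₀)
    (d := 2 * z₀ * R 0) (by fun_prop)
    (by
      simp only [zero_mul, mul_zero, hz₀, ne_eq, Nat.add_eq_zero_iff, one_ne_zero, and_false,
        not_false_eq_true, zero_pow, OfNat.ofNat_ne_zero, hP0, hR0]
      field_simp; ring)
    (by
      simpa [hP0, hR0] using
        ((hasDerivAt_pow 2 z₀).mul_const (R 0)).const_add (g 0 * P 0))
    (by positivity)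
  refine ⟨g', hg', by rwa [hg'0], ?_⟩
  filter_upwards [hgev] with u hu
  rw [h.eq]
  linear_combination u ^ 2 * hu

/-- The branch of the chain of layers: the `j`-th nontrivial layer is `u g_j(u)` with
`u = |t|^(2^(-j))`. -/
theorem IsNormalForm.exists_chain (h : IsNormalForm F P R S) (hP : P 0 ≠ 0) (hR : R 0 ≠ 0)
    (hS : S 0 ≠ 0) :
    ∃ ε : ℝ, (ε = 1 ∨ ε = -1) ∧ ∃ g : ℕ → ℝ → ℝ, (∀ j, ContDiff ℝ ∞ (g j)) ∧ (∀ j, g j 0 ≠ 0) ∧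
      (∀ᶠ u in 𝓝 0, F (u * g 0 u, 0, ε * u) = 0) ∧
      ∀ j, ∀ᶠ u in 𝓝 0, F (u * g (j + 1) u, u ^ 2 * g j (u ^ 2), ε * u ^ 2 ^ (j + 1)) = 0 := by
  obtain ⟨ε, hε, g₀, hg₀, hs₀, hF₀⟩ := h.exists_transcritical hP hR hS
  choose next hnext hnexts hnextF using fun (g : {g : ℝ → ℝ // ContDiff ℝ ∞ g ∧
    g 0 * (P 0 * R 0) < 0}) (e : ℕ) => h.exists_square_root hR g.2.1 g.2.2 ε e
  -- The sign condition is carried along in the subtype. The exponent `2 ^ (j + 1) - 2` makes `e +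
  -- 2` equal to `2 ^ (j + 1)`, the power for which `ε * u ^ (e + 2)` is the original parameter.
  let G : ℕ → {g : ℝ → ℝ // ContDiff ℝ ∞ g ∧ g 0 * (P 0 * R 0) < 0} := fun j =>
    Nat.rec ⟨g₀, hg₀, hs₀⟩ (fun j g => ⟨next g (2 ^ (j + 1) - 2), hnext _ _, hnexts _ _⟩) j
  refine ⟨ε, hε, fun j => (G j).1, fun j => (G j).2.1, fun j h0 => ?_, hF₀, fun j => ?_⟩
  · have := (G j).2.2
    simp only [h0, zero_mul, lt_self_iff_false] at this
  · have h2 : 2 ^ (j + 1) - 2 + 2 = 2 ^ (j + 1) := by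
      have : 2 ≤ 2 ^ (j + 1) := by
        rw [pow_succ]; exact Nat.le_mul_of_pos_left 2 (by positivity)
      omega
    have := hnextF (G j) (2 ^ (j + 1) - 2)
    rw [h2] at this
    exact this

/-! ### Nondegeneracy and genericity -/

section Derivatives

variable {E : Type*} [NormedAddCommGroup E] [NormedSpace ℝ E] {f : E → ℝ}

theorem iteratedFDeriv_one_zero_eq_deriv (hf : ContDiff ℝ ∞ f) (v : E) :
    iteratedFDeriv ℝ 1 f 0 ![v] = deriv (fun t : ℝ => f (t • v)) 0 := by
  have hd : Differentiable ℝ f := hf.differentiable (by simp)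
  have h1 : HasDerivAt (fun t : ℝ => t • v) v 0 := by
    simpa using (hasDerivAt_id (0 : ℝ)).smul_const v
  have h2 := (hd ((0 : ℝ) • v)).hasFDerivAt.comp_hasDerivAt (0 : ℝ) h1
  rw [zero_smul] at h2
  rw [iteratedFDeriv_one_apply]
  exact h2.deriv.symm

theorem iteratedFDeriv_two_zero_eq_deriv (hf : ContDiff ℝ ∞ f) (v w : E) :
    iteratedFDeriv ℝ 2 f 0 ![v, w]
      = deriv (fun t : ℝ => deriv (fun x : ℝ => f (t • v + x • w)) 0) 0 := by
  have hd : Differentiable ℝ f := hf.differentiable (by simp)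
  have hd2 : Differentiable ℝ (fderiv ℝ f) :=
    (hf.fderiv_right (m := ∞) (by simp)).differentiable (by simp)
  have h1 : ∀ t : ℝ, deriv (fun x : ℝ => f (t • v + x • w)) 0 = fderiv ℝ f (t • v) w := by
    intro t
    have h1 : HasDerivAt (fun x : ℝ => t • v + x • w) w 0 := by
      simpa using ((hasDerivAt_id (0 : ℝ)).smul_const w).const_add (t • v)
    have h2 := (hd (t • v + (0 : ℝ) • w)).hasFDerivAt.comp_hasDerivAt (0 : ℝ) h1
    rw [zero_smul, add_zero] at h2
    exact h2.deriv
  simp only [h1]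
  have h3 : HasDerivAt (fun t : ℝ => t • v) v 0 := by
    simpa using (hasDerivAt_id (0 : ℝ)).smul_const v
  have h4 := (hd2 ((0 : ℝ) • v)).hasFDerivAt.comp_hasDerivAt (0 : ℝ) h3
  rw [zero_smul] at h4
  have h5 := h4.clm_apply (hasDerivAt_const (0 : ℝ) w)
  rw [iteratedFDeriv_two_apply]
  simpa using h5.deriv.symm

end Derivatives

variable {k : ℕ}

/-- The nondegeneracy conditions on the derivatives of `f` at the origin: the sum of the
derivatives with respect to the inputs, the second derivative with respect to the internal
variable, and the mixed derivative with respect to the parameter and the internal variable do not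
vanish. -/
def Nondegenerate (f : Arg k → ℝ) : Prop :=
  iteratedFDeriv ℝ 1 f 0 ![(0, 1, 0)] ≠ 0 ∧
    iteratedFDeriv ℝ 2 f 0 ![(1, 0, 0), (1, 0, 0)] ≠ 0 ∧
    iteratedFDeriv ℝ 2 f 0 ![(0, 0, 1), (1, 0, 0)] ≠ 0

theorem isWeaklyOpenIn_self (X : Set (Arg k → ℝ)) : IsWeaklyOpenIn X X :=
  fun _ _ => ⟨∅, 0, 1, isCompact_empty, one_pos, fun _ hg _ => hg⟩

theorem isStronglyDenseIn_self (X : Set (Arg k → ℝ)) : IsStronglyDenseIn X X :=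
  fun f hf n ε _ hpos => ⟨f, hf, fun v j _ => by
    have : (fun w => f w - f w) = fun _ => (0 : ℝ) := by funext; simp
    rw [this]
    simpa using hpos v⟩

theorem IsWeaklyOpenIn.inter {G G' X : Set (Arg k → ℝ)} (h : IsWeaklyOpenIn G X)
    (h' : IsWeaklyOpenIn G' X) : IsWeaklyOpenIn (G ∩ G') X := by
  rintro f ⟨hf, hf'⟩
  obtain ⟨K, n, ε, hK, hε, H⟩ := h f hf
  obtain ⟨K', n', ε', hK', hε', H'⟩ := h' f hf'
  refine ⟨K ∪ K', max n n', min ε ε', hK.union hK', lt_min hε hε', fun g hg hgf => ⟨?_, ?_⟩⟩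
  · exact H g hg fun v hv j hj =>
      (hgf v (Or.inl hv) j (hj.trans (le_max_left _ _))).trans_le (min_le_left _ _)
  · exact H' g hg fun v hv j hj =>
      (hgf v (Or.inr hv) j (hj.trans (le_max_right _ _))).trans_le (min_le_right _ _)

theorem isWeaklyOpenIn_iteratedFDeriv_ne_zero {X : Set (Arg k → ℝ)}
    (hX : ∀ f ∈ X, ContDiff ℝ ∞ f) (n : ℕ) (m : Fin n → Arg k) :
    IsWeaklyOpenIn {f ∈ X | iteratedFDeriv ℝ n f 0 m ≠ 0} X := by
  rintro f ⟨hfX, hf⟩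
  have hpos : 0 < |iteratedFDeriv ℝ n f 0 m| := abs_pos.2 hf
  have hm : 0 ≤ ∏ i, ‖m i‖ := Finset.prod_nonneg fun i _ => norm_nonneg _
  -- The `+ 1` keeps the denominator positive when some direction is zero.
  refine ⟨{0}, n, |iteratedFDeriv ℝ n f 0 m| / (∏ i, ‖m i‖ + 1), isCompact_singleton,
    by positivity, fun g hg hgf => ⟨hg, fun h0 => ?_⟩⟩
  have h1 := hgf 0 rfl n le_rfl
  have h2 : iteratedFDeriv ℝ n (fun w => g w - f w) 0
      = iteratedFDeriv ℝ n g 0 - iteratedFDeriv ℝ n f 0 :=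
    iteratedFDeriv_sub_apply ((hX g hg).of_le (by exact_mod_cast le_top)).contDiffAt
      ((hX f hfX).of_le (by exact_mod_cast le_top)).contDiffAt
  have h3 := (iteratedFDeriv ℝ n (fun w => g w - f w) 0).le_opNorm m
  rw [h2, sub_apply, h0, zero_sub, norm_neg, Real.norm_eq_abs, ← h2] at h3
  have h4 : ‖iteratedFDeriv ℝ n (fun w => g w - f w) 0‖ * (∏ i, ‖m i‖ + 1)
      < |iteratedFDeriv ℝ n f 0 m| := (lt_div_iff₀ (by positivity)).1 h1
  nlinarith [norm_nonneg (iteratedFDeriv ℝ n (fun w => g w - f w) 0)]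

theorem contDiff_of_mem_V₀ {f : Arg k → ℝ} (hf : f ∈ V₀ k) : ContDiff ℝ ∞ f := hf.1.1

theorem isWeaklyOpenIn_nondegenerate : IsWeaklyOpenIn {f ∈ V₀ k | Nondegenerate f} (V₀ k) := by
  have h := fun n m => isWeaklyOpenIn_iteratedFDeriv_ne_zero (k := k)
    (fun f hf => contDiff_of_mem_V₀ hf) n m
  convert (h 1 ![(0, 1, 0)]).inter
    ((h 2 ![(1, 0, 0), (1, 0, 0)]).inter (h 2 ![(0, 0, 1), (1, 0, 0)])) using 1
  ext f
  simp only [Nondegenerate, mem_ofPred_eq, mem_inter_iff]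
  tauto

/-- The polynomial `x₀² + x₀ t + ∑ xᵢ`, for which the nondegeneracy conditions hold. -/
def perturbation (k : ℕ) (v : Arg k) : ℝ := v.1 ^ 2 + v.1 * v.2.2 + ∑ i, v.2.1 i

theorem contDiff_perturbation : ContDiff ℝ ∞ (perturbation k) := by
  unfold perturbation
  refine ContDiff.add (by fun_prop) (ContDiff.sum fun i _ => ?_)
  exact (contDiff_apply ℝ ℝ i).comp (contDiff_fst.comp contDiff_snd)

theorem nondegenerate_perturbation (hk : k ≠ 0) : Nondegenerate (perturbation k) := by
  refine ⟨?_, ?_, ?_⟩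
  · rw [iteratedFDeriv_one_zero_eq_deriv contDiff_perturbation]
    simpa [perturbation, deriv_const_mul_field] using hk
  · rw [iteratedFDeriv_two_zero_eq_deriv contDiff_perturbation]
    have h1 : ∀ t : ℝ, HasDerivAt (fun x : ℝ => (t + x) ^ 2) (2 * t) 0 := fun t =>
      (((hasDerivAt_id' (0 : ℝ)).const_add t).fun_pow 2).congr_deriv (by simp)
    have h2 : HasDerivAt (fun t : ℝ => 2 * t) 2 0 := by
      simpa using (hasDerivAt_id (0 : ℝ)).const_mul 2
    have : ∀ t x : ℝ, perturbation k (t • (1, 0, 0) + x • (1, 0, 0)) = (t + x) ^ 2 := by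
      intro t x; simp [perturbation]
    simp only [this, (h1 _).deriv, h2.deriv]
    norm_num
  · rw [iteratedFDeriv_two_zero_eq_deriv contDiff_perturbation]
    have h1 : ∀ t : ℝ, HasDerivAt (fun x : ℝ => x ^ 2 + x * t) t 0 := fun t =>
      (((hasDerivAt_id' (0 : ℝ)).fun_pow 2).fun_add
        ((hasDerivAt_id' (0 : ℝ)).mul_const t)).congr_deriv (by simp)
    have : ∀ t x : ℝ, perturbation k (t • (0, 0, 1) + x • (1, 0, 0)) = x ^ 2 + x * t := by
      intro t x; simp [perturbation]
    simp only [this, (h1 _).deriv]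
    simp

theorem exists_forall_norm_iteratedFDeriv_le {E : Type*} [NormedAddCommGroup E]
    [NormedSpace ℝ E] {φ : E → ℝ} (hφ : ContDiff ℝ ∞ φ) (hc : HasCompactSupport φ) (n : ℕ) :
    ∃ M, 0 < M ∧ ∀ j ≤ n, ∀ v, ‖iteratedFDeriv ℝ j φ v‖ ≤ M := by
  induction n with
  | zero =>
    obtain ⟨M, hM⟩ := (hc.iteratedFDeriv (𝕜 := ℝ) 0).exists_bound_of_continuous
      (hφ.continuous_iteratedFDeriv (by exact_mod_cast le_top))
    refine ⟨max M 1, by positivity, fun j hj v => ?_⟩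
    obtain rfl : j = 0 := by omega
    exact (hM v).trans (le_max_left _ _)
  | succ n ih =>
    obtain ⟨M', hM'0, hM'⟩ := ih
    obtain ⟨M, hM⟩ := (hc.iteratedFDeriv (𝕜 := ℝ) (n + 1)).exists_bound_of_continuous
      (hφ.continuous_iteratedFDeriv (by exact_mod_cast le_top))
    refine ⟨max M M', lt_max_of_lt_right hM'0, fun j hj v => ?_⟩
    rcases hj.lt_or_eq with h | rfl
    · exact (hM' j (by omega) v).trans (le_max_right _ _)
    · exact (hM v).trans (le_max_left _ _)

theorem eventually_add_mul_ne_zero (a : ℝ) {b : ℝ} (hb : b ≠ 0) :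
    ∀ᶠ s in 𝓝[≠] (0 : ℝ), a + s * b ≠ 0 := by
  by_cases ha : a = 0
  · filter_upwards [self_mem_nhdsWithin] with s hs
    simpa [ha, hb] using hs
  · have : ContinuousAt (fun s : ℝ => a + s * b) 0 := by fun_prop
    exact nhdsWithin_le_nhds (this.eventually_ne (by simpa using ha))

/-- Adding `s • φ`, with `φ` the cut-off polynomial, shifts each of the three derivatives by `s`
times a nonzero number, so all small `s ≠ 0` work. Compact support reduces the strong topology to a
uniform bound, since `ε` has a positive lower bound there. Both conditions defining `V₀` survive:
the polynomial vanishes on the `t`-axis and is `x²` on the `x`-axis. -/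
theorem isStronglyDenseIn_nondegenerate (hk : k ≠ 0) :
    IsStronglyDenseIn {f ∈ V₀ k | Nondegenerate f} (V₀ k) := by
  intro f hf n ε hε hε0
  let χ : ContDiffBump (0 : Arg k) := ⟨1, 2, one_pos, one_lt_two⟩
  let φ : Arg k → ℝ := fun v => χ v * perturbation k v
  have hφ : ContDiff ℝ ∞ φ := χ.contDiff.mul contDiff_perturbation
  have hφc : HasCompactSupport φ := χ.hasCompactSupport.mul_right
  have hφeq : φ =ᶠ[𝓝 0] perturbation k := by
    filter_upwards [χ.eventuallyEq_one] with v hv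
    simp [φ, hv]
  obtain ⟨M, hM0, hM⟩ := exists_forall_norm_iteratedFDeriv_le hφ hφc n
  obtain ⟨δ, hδ0, hδ⟩ : ∃ δ > 0, ∀ v ∈ tsupport φ, δ ≤ ε v := by
    rcases (tsupport φ).eq_empty_or_nonempty with h | h
    · exact ⟨1, one_pos, by simp [h]⟩
    · obtain ⟨v₀, _, hv₀⟩ := hφc.isCompact.exists_isMinOn h hε.continuousOn
      exact ⟨ε v₀, hε0 v₀, fun v hv => hv₀ hv⟩
  obtain ⟨p1, p2, p3⟩ := nondegenerate_perturbation hk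
  have hsmall : ∀ᶠ s in 𝓝[≠] (0 : ℝ), |s| * M < δ := by
    have : ContinuousAt (fun s : ℝ => |s| * M) 0 := by fun_prop
    exact nhdsWithin_le_nhds (this.eventually_lt_const (by simpa using hδ0))
  obtain ⟨s, ⟨⟨h1, h2⟩, h3⟩, hs⟩ := (((eventually_add_mul_ne_zero
    (iteratedFDeriv ℝ 1 f 0 ![(0, 1, 0)]) p1).and (eventually_add_mul_ne_zero
    (iteratedFDeriv ℝ 2 f 0 ![(1, 0, 0), (1, 0, 0)]) p2)).and (eventually_add_mul_ne_zero
    (iteratedFDeriv ℝ 2 f 0 ![(0, 0, 1), (1, 0, 0)]) p3)).and hsmall |>.exists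
  have hfs := contDiff_of_mem_V₀ hf
  have hsφ : ContDiff ℝ ∞ (s • φ) := contDiff_const.smul hφ
  have hφd : ∀ j : ℕ, ∀ v, iteratedFDeriv ℝ j (s • φ) v = s • iteratedFDeriv ℝ j φ v :=
    fun j v => iteratedFDeriv_const_smul_apply (hφ.of_le (by exact_mod_cast le_top)).contDiffAt
  have hsum : ∀ (j : ℕ) (m : Fin j → Arg k), iteratedFDeriv ℝ j (f + s • φ) 0 m
      = iteratedFDeriv ℝ j f 0 m + s * iteratedFDeriv ℝ j (perturbation k) 0 m := by
    intro j m
    rw [iteratedFDeriv_add_apply (hfs.of_le (by exact_mod_cast le_top)).contDiffAt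
      (hsφ.of_le (by exact_mod_cast le_top)).contDiffAt, hφd,
      (hφeq.iteratedFDeriv ℝ j).eq_of_nhds]
    simp
  refine ⟨f + s • φ, ⟨⟨⟨hfs.add hsφ, fun t => ?_⟩, ?_⟩, ?_⟩, fun v j hj => ?_⟩
  · simp [hf.1.2 t, φ, perturbation]
  · have hx : Tendsto (fun x : ℝ => ((x, 0, 0) : Arg k)) (𝓝 0) (𝓝 0) :=
      (by fun_prop : Continuous fun x : ℝ => ((x, 0, 0) : Arg k)).tendsto 0
    have heq : (fun x : ℝ => (f + s • φ) (x, 0, 0)) =ᶠ[𝓝 0] fun x => f (x, 0, 0) + s * x ^ 2 := by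
      filter_upwards [hx.eventually hφeq] with x hx
      simp [hx, perturbation]
    have hd : DifferentiableAt ℝ (fun x : ℝ => f (x, 0, 0)) 0 :=
      ((hfs.comp (by fun_prop : ContDiff ℝ ∞ fun x : ℝ => ((x, 0, 0) : Arg k))).differentiable
        (by simp)) 0
    rw [heq.deriv_eq, deriv_fun_add hd (by fun_prop), hf.2]
    simp
  · simp only [Nondegenerate, hsum]
    exact ⟨h1, h2, h3⟩
  · have hdiff : (fun w => (f + s • φ) w - f w) = s • φ := by funext w; simp
    rw [hdiff, hφd]
    by_cases hv : v ∈ tsupport φ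
    · calc ‖s • iteratedFDeriv ℝ j φ v‖ = |s| * ‖iteratedFDeriv ℝ j φ v‖ := by
            rw [norm_smul, Real.norm_eq_abs]
        _ ≤ |s| * M := by gcongr; exact hM j hj v
        _ < δ := hs
        _ ≤ ε v := hδ v hv
    · have : iteratedFDeriv ℝ j φ v = 0 :=
        image_eq_zero_of_notMem_tsupport fun h => hv (tsupport_iteratedFDeriv_subset j h)
      rw [this]
      simpa using hε0 v

theorem exists_isNormalForm_of_nondegenerate {f : Arg k → ℝ} (hf : f ∈ V₀ k)
    (hnd : Nondegenerate f) :
    ∃ P R S, IsNormalForm (fun p => f (p.1, fun _ => p.2.1, p.2.2)) P R S ∧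
      P 0 ≠ 0 ∧ R 0 ≠ 0 ∧ S 0 ≠ 0 := by
  have hfs := contDiff_of_mem_V₀ hf
  have hF : ContDiff ℝ ∞ fun p : ℝ × ℝ × ℝ => f (p.1, fun _ => p.2.1, p.2.2) :=
    hfs.comp (by fun_prop)
  obtain ⟨P, R, S, h⟩ := exists_isNormalForm hF hf.1.2 hf.2
  obtain ⟨h1, h2, h3⟩ := hnd
  rw [iteratedFDeriv_one_zero_eq_deriv hfs] at h1
  rw [iteratedFDeriv_two_zero_eq_deriv hfs] at h2 h3
  have e1 := h.hasDerivAt_input.deriv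
  have e2 := h.deriv_deriv_internal
  have e3 := h.deriv_deriv_parameter
  have hone : ∀ y : ℝ, y • (1 : Fin k → ℝ) = fun _ => y := fun y => by ext; simp
  have hzero : (0 : Fin k → ℝ) = fun _ => 0 := rfl
  simp only [Prod.smul_mk, Prod.mk_add_mk, smul_eq_mul, mul_one, mul_zero, add_zero, zero_add,
    smul_zero, hone] at h1 h2 h3
  rw [hzero] at h2 h3
  refine ⟨P, R, S, h, ?_, ?_, ?_⟩
  · rwa [← e1]
  · rw [e2] at h2
    exact right_ne_zero_of_mul h2
  · rwa [← e3]

/-! ### One-sided domains and iterated square roots -/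

/-- The one-sided domain of length `a` on the side of the sign `ε = ±1`. -/
def oneSided (ε a : ℝ) : Set ℝ := {t | 0 ≤ ε * t ∧ ε * t < a}

theorem oneSided_one (a : ℝ) : oneSided 1 a = Ico 0 a := by
  ext t; simp [oneSided]

theorem oneSided_neg_one (a : ℝ) : oneSided (-1) a = Ioc (-a) 0 := by
  ext t
  simp only [oneSided, mem_ofPred_eq, mem_Ioc]
  constructor <;> rintro ⟨h1, h2⟩ <;> constructor <;> linarith

variable {ε a : ℝ}

theorem sq_eq_one_of_sign (hε : ε = 1 ∨ ε = -1) : ε * ε = 1 := by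
  rcases hε with rfl | rfl <;> norm_num

theorem abs_eq_of_mem_oneSided (hε : ε = 1 ∨ ε = -1) {t : ℝ} (ht : t ∈ oneSided ε a) :
    |t| = ε * t := by
  have h1 : |ε| = 1 := by rcases hε with rfl | rfl <;> simp
  rw [← one_mul |t|, ← h1, ← abs_mul, abs_of_nonneg ht.1]

theorem mem_oneSided_mul {ε : ℝ} (hε : ε = 1 ∨ ε = -1) {u : ℝ} :
    ε * u ∈ oneSided ε a ↔ 0 ≤ u ∧ u < a := by
  simp [oneSided, ← mul_assoc, sq_eq_one_of_sign hε]

theorem neBot_nhdsWithin_oneSided (hε : ε = 1 ∨ ε = -1) (ha : 0 < a) :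
    (𝓝[oneSided ε a \ {0}] 0).NeBot := by
  rcases hε with rfl | rfl
  · rw [oneSided_one, Ico_sdiff_left, nhdsWithin_Ioo_eq_nhdsGT ha]
    infer_instance
  · rw [oneSided_neg_one, Ioc_sdiff_right, nhdsWithin_Ioo_eq_nhdsLT (by linarith)]
    infer_instance

/-- The root `|t|^(2^(-q))`. -/
noncomputable def root (q : ℕ) (t : ℝ) : ℝ := |t| ^ ((2 : ℝ) ^ q)⁻¹

theorem root_zero_left (t : ℝ) : root 0 t = |t| := by simp [root]

theorem root_nonneg (q : ℕ) (t : ℝ) : 0 ≤ root q t := by unfold root; positivity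

theorem root_pos (q : ℕ) {t : ℝ} (ht : t ≠ 0) : 0 < root q t := by unfold root; positivity

theorem root_zero_right (q : ℕ) : root q 0 = 0 := by
  unfold root
  rw [abs_zero, Real.zero_rpow (by positivity)]

theorem root_pow (q : ℕ) (t : ℝ) : root q t ^ 2 ^ q = |t| := by
  unfold root
  rw [← Real.rpow_natCast, ← Real.rpow_mul (abs_nonneg t)]
  simp

theorem root_succ_sq (q : ℕ) (t : ℝ) : root (q + 1) t ^ 2 = root q t := by
  unfold root
  rw [← Real.rpow_natCast, ← Real.rpow_mul (abs_nonneg t)]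
  congr 1
  rw [pow_succ]
  push_cast
  field_simp

theorem continuous_root (q : ℕ) : Continuous (root q) :=
  continuous_abs.rpow_const fun _ => Or.inr (by positivity)

theorem tendsto_root (q : ℕ) : Tendsto (root q) (𝓝 0) (𝓝 0) := by
  simpa [root_zero_right] using (continuous_root q).tendsto 0

theorem contDiffAt_root (q : ℕ) {t : ℝ} (ht : t ≠ 0) : ContDiffAt ℝ ∞ (root q) t :=
  (contDiffAt_abs ht).rpow_const_of_ne (abs_ne_zero.2 ht)

/-- This substitution turns the limit of `γ |t| / t` in `HasRootExpansion` into one of `β t / root q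
t`, up to sign. -/
theorem tendsto_sign_mul_root (hε : ε = 1 ∨ ε = -1) (ha : 0 < a) (q : ℕ) :
    Tendsto (fun t => ε * root q t) (𝓝[oneSided ε a \ {0}] 0) (𝓝[oneSided ε a \ {0}] 0) := by
  have h0 : Tendsto (root q) (𝓝[oneSided ε a \ {0}] 0) (𝓝 0) :=
    (tendsto_root q).mono_left nhdsWithin_le_nhds
  refine tendsto_nhdsWithin_iff.2 ⟨by simpa using h0.const_mul ε, ?_⟩
  filter_upwards [h0.eventually_lt_const ha, self_mem_nhdsWithin] with t h1 h2
  have hε0 : ε ≠ 0 := by rcases hε with rfl | rfl <;> norm_num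
  exact ⟨(mem_oneSided_mul hε).2 ⟨root_nonneg q t, h1⟩, mul_ne_zero hε0 (root_pos q h2.2).ne'⟩

/-! ### Uniqueness of the square-root-order -/

variable {D : Set ℝ} {β : ℝ → ℝ}

theorem exists_eq_oneSided (hD : D = Ico 0 a ∨ D = Ioc (-a) 0) :
    ∃ ε : ℝ, (ε = 1 ∨ ε = -1) ∧ D = oneSided ε a := by
  rcases hD with rfl | rfl
  · exact ⟨1, Or.inl rfl, (oneSided_one a).symm⟩
  · exact ⟨-1, Or.inr rfl, (oneSided_neg_one a).symm⟩

theorem oneSided_cases (hε : ε = 1 ∨ ε = -1) :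
    oneSided ε a = Ico 0 a ∨ oneSided ε a = Ioc (-a) 0 := by
  rcases hε with rfl | rfl
  · exact Or.inl (oneSided_one a)
  · exact Or.inr (oneSided_neg_one a)

theorem HasRootExpansion.neBot {q : ℕ} {s : ℝ} (h : HasRootExpansion D β q s) :
    (𝓝[D \ {0}] 0).NeBot := by
  obtain ⟨a, ha, hD, -⟩ := h
  obtain ⟨ε, hε, rfl⟩ := exists_eq_oneSided hD
  exact neBot_nhdsWithin_oneSided hε ha

theorem HasRootExpansion.tendsto_abs_div_root {q : ℕ} {s : ℝ} (h : HasRootExpansion D β q s) :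
    Tendsto (fun t => |β t| / root q t) (𝓝[D \ {0}] 0) (𝓝 |s|) := by
  obtain ⟨a, ha, hD, γ, -, hβ, hγ, -⟩ := h
  obtain ⟨ε, hε, rfl⟩ := exists_eq_oneSided hD
  refine ((hγ.comp (tendsto_sign_mul_root hε ha q)).abs).congr' ?_
  filter_upwards [self_mem_nhdsWithin] with t ht
  have h1 : |ε| = 1 := by rcases hε with rfl | rfl <;> simp
  have h2 : |ε * root q t| = root q t := by
    rw [abs_mul, h1, one_mul, abs_of_nonneg (root_nonneg q t)]
  simp only [Function.comp_apply]
  rw [abs_div, h2, hβ t ht.1, root]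

/-- If `q' < q`, then `β` is of the size of `root q'`, a power at least `2` of `root q`; so `β /
root q` tends to `0`, against `s ≠ 0`. -/
theorem HasRootExpansion.le {q q' : ℕ} {s s' : ℝ} (h : HasRootExpansion D β q s)
    (h' : HasRootExpansion D β q' s') : q ≤ q' := by
  by_contra! hlt
  have := h.neBot
  have hs : s ≠ 0 := h.elim fun _ hh => hh.2.2.elim fun _ hh => hh.2.2.2
  obtain ⟨d, rfl⟩ := Nat.exists_eq_add_of_lt hlt
  have key : ∀ d : ℕ, ∀ t, root q' t = root (q' + d) t ^ 2 ^ d := by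
    intro d t
    induction d with
    | zero => simp
    | succ d ih => rw [ih, ← root_succ_sq, ← pow_mul, pow_succ']; rfl
  have h1 : Tendsto (fun t => root (q' + (d + 1)) t ^ (2 ^ (d + 1) - 1)) (𝓝[D \ {0}] 0) (𝓝 0) := by
    have h2 : 2 ^ (d + 1) - 1 ≠ 0 := by
      have := Nat.one_lt_two_pow (n := d + 1) (by omega)
      omega
    simpa [h2] using ((tendsto_root (q' + (d + 1))).mono_left nhdsWithin_le_nhds).pow
      (2 ^ (d + 1) - 1)
  have h2 := h'.tendsto_abs_div_root.mul h1
  rw [mul_zero] at h2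
  have h3 := tendsto_nhds_unique_of_eventuallyEq h.tendsto_abs_div_root h2 (by
    filter_upwards [self_mem_nhdsWithin] with t ht
    have hr := (root_pos (q' + (d + 1)) ht.2)
    rw [key (d + 1) t, show q' + d + 1 = q' + (d + 1) from rfl, div_mul_eq_mul_div,
      div_eq_div_iff hr.ne' (by positivity)]
    rw [mul_assoc, ← pow_succ, Nat.sub_add_cancel Nat.one_le_two_pow])
  exact hs (abs_eq_zero.1 h3)

theorem HasRootExpansion.not_eventually_eq_zero {q : ℕ} {s : ℝ} (h : HasRootExpansion D β q s) :
    ¬ ∀ᶠ t in 𝓝[D] 0, β t = 0 := by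
  intro h0
  have := h.neBot
  have hs : s ≠ 0 := h.elim fun _ hh => hh.2.2.elim fun _ hh => hh.2.2.2
  have h1 : (fun t => |β t| / root q t) =ᶠ[𝓝[D \ {0}] 0] fun _ => 0 := by
    filter_upwards [h0.filter_mono (nhdsWithin_mono 0 sdiff_subset)] with t ht
    simp [ht]
  exact hs (abs_eq_zero.1 (tendsto_nhds_unique_of_eventuallyEq h.tendsto_abs_div_root
    tendsto_const_nhds h1))

theorem HasRootExpansion.hasSqrtOrder {q : ℕ} {s : ℝ} (h : HasRootExpansion D β q s) :
    HasSqrtOrder D β q := by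
  refine Or.inr ⟨fun h0 => h.not_eventually_eq_zero ?_, q, rfl, ⟨s, h⟩, ?_⟩
  · filter_upwards [self_mem_nhdsWithin] with t ht using h0 t ht
  · rintro q' ⟨s', h'⟩
    exact h.le h'

theorem HasRootExpansion.eq_of_hasSqrtOrder {q : ℕ} {s : ℝ} (h : HasRootExpansion D β q s)
    {p : ℤ} (hp : HasSqrtOrder D β p) : p = q := by
  rcases hp with ⟨-, h0⟩ | ⟨-, n, rfl, hn⟩
  · refine absurd ?_ h.not_eventually_eq_zero
    filter_upwards [self_mem_nhdsWithin] with t ht using h0 t ht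
  · obtain ⟨s', h'⟩ := hn.1
    rw [le_antisymm (h'.le h) (h.le h')]

theorem hasRootExpansion_root_mul (hε : ε = 1 ∨ ε = -1) (ha : 0 < a) {g : ℝ → ℝ}
    (hg : ContDiff ℝ ∞ g) (hg0 : g 0 ≠ 0) (q : ℕ) :
    HasRootExpansion (oneSided ε a) (fun t => root q t * g (root q t)) q (ε * g 0) := by
  have hε0 : ε ≠ 0 := by rcases hε with rfl | rfl <;> norm_num
  refine ⟨a, ha, oneSided_cases hε, fun u => u * g u, (contDiff_id.mul hg).contDiffOn,
    fun t _ => rfl, ?_, mul_ne_zero hε0 hg0⟩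
  have h1 : Tendsto (fun t => ε * g |t|) (𝓝[oneSided ε a \ {0}] 0) (𝓝 (ε * g 0)) := by
    have : Continuous fun t => ε * g |t| := continuous_const.mul (hg.continuous.comp continuous_abs)
    simpa using (this.tendsto 0).mono_left nhdsWithin_le_nhds
  refine h1.congr' ?_
  filter_upwards [self_mem_nhdsWithin] with t ht
  have h0 : t ≠ 0 := ht.2
  nth_rewrite 2 [abs_eq_of_mem_oneSided hε ht.1]
  field_simp

/-! ### Assembling the branch on the network -/

/-- The value of the branch on the `n`-th layer. -/
noncomputable def layerValue (g : ℕ → ℝ → ℝ) (r n : ℕ) (t : ℝ) : ℝ :=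
  if n < r then 0 else root (n - r) t * g (n - r) (root (n - r) t)

variable {g : ℕ → ℝ → ℝ}

theorem layerValue_of_lt {r n : ℕ} (h : n < r) (t : ℝ) : layerValue g r n t = 0 := if_pos h

theorem layerValue_add (r i : ℕ) (t : ℝ) :
    layerValue g r (r + i) t = root i t * g i (root i t) := by
  simp [layerValue]

theorem continuous_layerValue (hg : ∀ j, ContDiff ℝ ∞ (g j)) (r n : ℕ) :
    Continuous (layerValue g r n) := by
  unfold layerValue
  split_ifs
  · exact continuous_const
  · exact (continuous_root _).mul ((hg _).continuous.comp (continuous_root _))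

theorem contDiffAt_layerValue (hg : ∀ j, ContDiff ℝ ∞ (g j)) (r n : ℕ) {t : ℝ} (ht : t ≠ 0) :
    ContDiffAt ℝ ∞ (layerValue g r n) t := by
  unfold layerValue
  split_ifs
  · exact contDiffAt_const
  · exact (contDiffAt_root _ ht).mul ((hg _).contDiffAt.comp t (contDiffAt_root _ ht))

/-- The nontrivial layers, each with one common value, solve the equilibrium equations. -/
theorem exists_layerValue {k : ℕ} {f : Arg k → ℝ} (hf : f ∈ V₀ k) (hnd : Nondegenerate f)
    (r m : ℕ) :
    ∃ ε : ℝ, (ε = 1 ∨ ε = -1) ∧ ∃ g : ℕ → ℝ → ℝ, (∀ j, ContDiff ℝ ∞ (g j)) ∧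
      (∀ j, g j 0 ≠ 0) ∧ ∃ a : ℝ, 0 < a ∧ ∀ n < m, ∀ t ∈ oneSided ε a,
        f (layerValue g r (n + 1) t, fun _ => layerValue g r n t, t) = 0 := by
  obtain ⟨P, R, S, h, hP, hR, hS⟩ := exists_isNormalForm_of_nondegenerate hf hnd
  obtain ⟨ε, hε, g, hg, hg0, hfirst, hnext⟩ := h.exists_chain hP hR hS
  -- Writing `ε * |t|` for the parameter gives a statement on a full neighbourhood; on `oneSided ε
  -- a` it is `t` itself. Only finitely many layers occur, so one `a` serves all.
  have hev : ∀ᶠ t in 𝓝 (0 : ℝ), ∀ n ∈ Finset.range m,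
      f (layerValue g r (n + 1) t, fun _ => layerValue g r n t, ε * |t|) = 0 := by
    rw [Filter.eventually_all_finset]
    intro n _
    -- The target layer `n + 1` is trivial, the transcritical layer, or a square-root layer.
    rcases lt_trichotomy (n + 1) r with hn | rfl | hn
    · refine .of_forall fun t => ?_
      rw [layerValue_of_lt hn, layerValue_of_lt (by omega)]
      exact hf.1.2 _
    · filter_upwards [(tendsto_root 0).eventually hfirst] with t ht
      have := layerValue_add (g := g) (n + 1) 0 t
      rw [add_zero] at this
      rw [layerValue_of_lt (Nat.lt_succ_self n), this]
      rwa [root_zero_left] at ht ⊢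
    · obtain ⟨i, rfl⟩ := Nat.exists_eq_add_of_le (Nat.lt_succ_iff.1 hn)
      filter_upwards [(tendsto_root (i + 1)).eventually (hnext i)] with t ht
      rw [add_assoc, layerValue_add, layerValue_add]
      rwa [root_pow, root_succ_sq] at ht
  obtain ⟨a, ha, hball⟩ := Metric.eventually_nhds_iff.1 hev
  refine ⟨ε, hε, g, hg, hg0, a, ha, fun n hn t ht => ?_⟩
  have habs := abs_eq_of_mem_oneSided hε ht
  have h1 := hball (y := t) (by rw [Real.dist_eq, sub_zero, habs]; exact ht.2) n
    (Finset.mem_range.2 hn)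
  rwa [habs, ← mul_assoc, sq_eq_one_of_sign hε, one_mul] at h1

section Network

variable {C : Type*} {k m : ℕ} {σ : Fin k → C → C} {L : Fin (m + 1) → Set C}

theorem IsFeedForward.exists_layer (hN : IsFeedForward σ L) :
    ∃ ℓ : C → Fin (m + 1), ∀ c j, c ∈ L j → ℓ c = j := by
  have h : ∀ c, ∃ j, c ∈ L j := fun c => by
    have : c ∈ ⋃ j, L j := hN.layer_cover ▸ mem_univ c
    simpa using this
  choose ℓ hℓ using h
  refine ⟨ℓ, fun c j hc => ?_⟩
  by_contra hne
  exact Set.disjoint_left.1 (hN.layer_disjoint _ _ hne) (hℓ c) hc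

/-- Every edge into a layer starts in the one before it, so values constant on layers only have to
solve the chain equations; on layer `0` all arguments but `t` are zero. -/
theorem IsFeedForward.field_eq_zero (hN : IsFeedForward σ L) {f : Arg k → ℝ} {t : ℝ}
    (hf0 : f (0, 0, t) = 0) {ℓ : C → Fin (m + 1)} (hℓ : ∀ c j, c ∈ L j → ℓ c = j) {Y : ℕ → ℝ}
    (hY0 : Y 0 = 0) (hY : ∀ n < m, f (Y (n + 1), fun _ => Y n, t) = 0) :
    field σ f (fun c => Y (ℓ c)) t = 0 := by
  funext c
  obtain ⟨j, hj⟩ : ∃ j, c ∈ L j := by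
    have : c ∈ ⋃ j, L j := hN.layer_cover ▸ mem_univ c
    simpa using this
  simp only [field, Pi.zero_apply]
  refine Fin.cases (fun hj => ?_) (fun j hj => ?_) j hj
  · simp only [hN.fixed _ c hj, hℓ c 0 hj, Fin.val_zero, hY0]
    exact hf0
  · simp only [hℓ c _ hj, hℓ _ _ (hN.feed _ j c hj), Fin.val_succ, Fin.val_castSucc]
    exact hY j j.2

/-- Without inputs the derivative along them would vanish identically and no family would be
nondegenerate; a second layer forces an edge. -/
theorem IsFeedForward.ne_zero (hN : IsFeedForward σ L) (hm : m ≠ 0) : k ≠ 0 := by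
  rintro rfl
  obtain ⟨c, hc⟩ := hN.layer_nonempty 0
  obtain ⟨-, -, i, -⟩ := hN.feeds_next ⟨0, Nat.pos_of_ne_zero hm⟩ c hc
  exact i.elim0

theorem IsFeedForward.exists_branch [Fintype C] (hN : IsFeedForward σ L) {f : Arg k → ℝ} (hf : f ∈ V₀ k)
    (hnd : Nondegenerate f) {r : ℕ} (hr : 1 ≤ r) (hrm : r ≤ m) :
    ∃ (D : Set ℝ) (b : ℝ → C → ℝ), IsBifurcationBranch σ f D b ∧
      (∀ j : Fin (m + 1), (j : ℕ) < r → ∀ c ∈ L j, ∀ t ∈ D, b t c = 0) ∧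
      (∀ j : Fin (m + 1), r ≤ (j : ℕ) →
        HasSqrtOrderIn D b (L j) (((j : ℕ) : ℤ) - (r : ℤ))) := by
  obtain ⟨ε, hε, g, hg, hg0, a, ha, hY⟩ := exists_layerValue hf hnd r m
  obtain ⟨ℓ, hℓ⟩ := hN.exists_layer
  have hexp : ∀ i, HasRootExpansion (oneSided ε a) (fun t => layerValue g r (r + i) t) i
      (ε * g i 0) := by
    intro i
    simpa only [layerValue_add] using hasRootExpansion_root_mul hε ha (hg i) (hg0 i) i
  refine ⟨oneSided ε a, fun t c => layerValue g r (ℓ c) t,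
    ⟨⟨⟨a, ha, ?_⟩, ?_, ?_, ?_⟩, ?_⟩, ?_, ?_⟩
  · rcases oneSided_cases (a := a) hε with h | h <;> simp [h]
  · exact (continuous_pi fun c => continuous_layerValue hg r (ℓ c)).continuousOn
  · exact fun t ht => (contDiffAt_pi.2 fun c =>
      contDiffAt_layerValue hg r (ℓ c) ht.2).contDiffWithinAt
  · exact fun t ht => hN.field_eq_zero (Y := fun n => layerValue g r n t) (hf.1.2 t) hℓ
      (layerValue_of_lt (by omega) t) fun n hn => hY n hn t ht
  · intro h0
    obtain ⟨c, hc⟩ := hN.layer_nonempty ⟨r, by omega⟩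
    refine (hexp 0).not_eventually_eq_zero ?_
    filter_upwards [h0] with t ht
    simpa [hℓ c _ hc] using congrFun ht c
  · intro j hj c hc t _
    simp only [hℓ c j hc]
    exact layerValue_of_lt hj t
  · intro j hj
    obtain ⟨i, hi⟩ := Nat.exists_eq_add_of_le hj
    have hji : ((j : ℕ) : ℤ) - r = i := by rw [hi]; push_cast; ring
    have hc : ∀ c ∈ L j, HasRootExpansion (oneSided ε a) (fun t => layerValue g r (ℓ c) t) i
        (ε * g i 0) := by
      intro c hc
      rw [hℓ c j hc, hi]
      exact hexp i
    rw [hji]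
    refine ⟨fun c hcj => ⟨i, (hc c hcj).hasSqrtOrder⟩, ?_, ?_⟩
    · obtain ⟨c, hcj⟩ := hN.layer_nonempty j
      exact ⟨c, hcj, (hc c hcj).hasSqrtOrder⟩
    · rintro q ⟨c, hcj, hq⟩
      exact ((hc c hcj).eq_of_hasSqrtOrder hq).le

end Network

end FFN

theorem mainTheorem6 {C : Type*} [Fintype C] {k m : ℕ} (σ : Fin k → C → C)
    (L : Fin (m + 1) → Set C) (hN : FFN.IsFeedForward σ L) (hconn : FFN.IsConnectedNetwork σ) :
    FFN.Generically (FFN.V₀ k) fun f =>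
      ∀ r : ℕ, 1 ≤ r → r ≤ m →
        ∃ (D : Set ℝ) (b : ℝ → C → ℝ), FFN.IsBifurcationBranch σ f D b ∧
          (∀ j : Fin (m + 1), (j : ℕ) < r → ∀ c ∈ L j, ∀ t ∈ D, b t c = 0) ∧
          (∀ j : Fin (m + 1), r ≤ (j : ℕ) →
            FFN.HasSqrtOrderIn D b (L j) (((j : ℕ) : ℤ) - (r : ℤ))) := by
  -- For `m = 0` there is no `r` to treat, and `k` may be `0`, where nondegenerate families do not
  -- exist; hence all of `V₀` is taken.
  rcases eq_or_ne m 0 with hm | hm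
  · exact ⟨FFN.V₀ k, subset_rfl, FFN.isWeaklyOpenIn_self _, FFN.isStronglyDenseIn_self _,
      fun f _ r hr hrm => by omega⟩
  · exact ⟨{f ∈ FFN.V₀ k | FFN.Nondegenerate f}, fun f hf => hf.1,
      FFN.isWeaklyOpenIn_nondegenerate,
      FFN.isStronglyDenseIn_nondegenerate (hN.ne_zero hm),
      fun f hf r hr hrm => hN.exists_branch hf.1 hf.2 hr hrm⟩
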